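/- Let $r\ge 2$ be an integer and let $x_i$ ($1\le i\le r$) and $y_{i,j}$ ($2\le i\le j\le r$) be formal variables (equivalently, arbitrary elements of an arbitrary commutative ring). A tree is a connected acyclic graph. An unordered increasing tree with vertex-set $\{1,\dots,r\}$ is a rooted tree $T$ on $\{1,\dots,r\}$ (sons of a vertex are not ordered) in which every son is larger than its father; in particular the root is $1$. For a non-root vertex $v$ write $f_T(v)$ for the father of $v$, that is, the vertex that follows $v$ on the path from $v$ to the root, and for any vertex $v$ let the hook $\mathfrak h_T(v)$ be the set consisting of $v$ and all its descendants. Let $\mathcal U_r$ be the set of unordered increasing trees with vertex-set $\{1,\dots,r\}$, and for $T\in\mathcal U_r$ put $$\mathrm{wt}_y(T)=\prod_{v=2}^r\Big(x_{f_T(v)}\sum_{u\in\mathfrak h_T(v)}y_{v,u}\Big).$$ Then $$\sum_{T\in\mathcal U_r}\mathrm{wt}_y(T)=x_1\,y_{r,r}\prod_{i=2}^{r-1}\Big(\sum_{j=1}^{i}x_j\,y_{i,i}+\sum_{j=i+1}^{r}x_i\,y_{i,j}\Big).$$ -/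

import Mathlib

/-- The vertex-set `{1, …, r}`, ordered as natural numbers. -/
abbrev Vertex (r : ℕ) : Type := Finset.Icc 1 r

/-- A rooted (unordered) tree with vertex-set `V`: a connected acyclic graph on `V` together with
a distinguished vertex. -/
@[ext]
structure RootedTreeOn (V : Type*) where
  /-- the underlying graph -/
  graph : SimpleGraph V
  /-- it is connected and acyclic -/
  isTree : graph.IsTree
  /-- the distinguished vertex -/
  root : V

namespace RootedTreeOn

variable {V : Type*}

/-- The unique path from the vertex `v` to the root. -/
noncomputable def pathToRoot (T : RootedTreeOn V) (v : V) : T.graph.Walk v T.root :=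
  (T.isTree.existsUnique_path v T.root).choose

/-- `pathToRoot` is a path, and it is the only path from `v` to the root. -/
theorem pathToRoot_spec (T : RootedTreeOn V) (v : V) :
    (T.pathToRoot v).IsPath ∧ ∀ p : T.graph.Walk v T.root, p.IsPath → p = T.pathToRoot v :=
  (T.isTree.existsUnique_path v T.root).choose_spec

/-- The father of a vertex `v` other than the root: the vertex that follows `v` on the path from
`v` to the root. (The root has no father; the value there is the root itself and is not used.) -/
noncomputable def father (T : RootedTreeOn V) (v : V) : V :=
  (T.pathToRoot v).snd

/-- `u` is a son of `v`. -/
def IsSon (T : RootedTreeOn V) (u v : V) : Prop :=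
  u ≠ T.root ∧ T.father u = v

/-- `u` is a descendant of `v`: a son of `v`, or a son of a son of `v`, and so on. -/
def IsDescendant (T : RootedTreeOn V) (u v : V) : Prop :=
  Relation.TransGen T.IsSon u v

open Classical in
/-- The hook attached to `v`: the set consisting of `v` and its descendants. -/
noncomputable def hook [Fintype V] (T : RootedTreeOn V) (v : V) : Finset V :=
  {u | u = v ∨ T.IsDescendant u v}

/-- The labels increase from father to son. -/
def IsIncreasing [LT V] (T : RootedTreeOn V) : Prop :=
  ∀ u v : V, T.IsSon u v → v < u

noncomputable instance [Finite V] : Fintype (RootedTreeOn V) :=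
  have : Finite (RootedTreeOn V) :=
    Finite.of_injective (fun T : RootedTreeOn V => (T.graph, T.root)) fun _ _ h =>
      RootedTreeOn.ext (congrArg Prod.fst h) (congrArg Prod.snd h)
  Fintype.ofFinite _

end RootedTreeOn

open Classical in
/-- The finite set of unordered increasing trees with vertex-set `{1, …, r}`. -/
noncomputable def increasingTrees (r : ℕ) : Finset (RootedTreeOn (Vertex r)) :=
  {T | T.IsIncreasing}

/-- The weight `∏_{v=2}^r (x_{f_T(v)} ∑_{u ∈ 𝔥_T(v)} y_{v,u})` of a tree. -/
noncomputable def hookWeight {R : Type*} [CommRing R] {r : ℕ} (x : ℕ → R) (y : ℕ → ℕ → R)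
    (T : RootedTreeOn (Vertex r)) : R :=
  ∏ v ∈ Finset.univ.filter (fun v : Vertex r => 2 ≤ (v : ℕ)),
    (x (T.father v) * ∑ u ∈ T.hook v, y v u)

/-! An increasing tree amounts to a choice of a smaller father for each vertex other than 1, so the
sum runs over father maps and one can induct on the largest vertex, which is a leaf. Hanging a leaf
`s` on `w` contributes `x w * y s s` and adds `y v s` to the hook sum of every `v` that is `w` or an
ancestor of `w`.

Expand the product of these enlarged hook sums by the largest vertex `m` whose summand `y m s` is
chosen (`prod_add_ordered`). Ancestors form a chain, so below `m` the condition on `v` depends on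
`m` only, not on `w`. Summing `x w` over the `w` in the hook of `m` then leaves the weight of the
smaller tree for a modified array, `twist`. Thus the sum for `y` is expressed through sums on one
vertex fewer, for `y` and its twists (`sum_weight_succ`).

The product formula obeys the same recursion, by the same ordered expansion
(`product_formula_succ`). The induction must therefore be over all arrays `y` at once. -/

namespace FatherMap

open Finset

/-! ### Father maps, enumerated by adding the largest vertex -/

/-- `f` is the father map of an increasing tree on `{1, …, n + 1}`, extended by `0`. -/
def IsFatherMap (n : ℕ) (f : ℕ → ℕ) : Prop :=
  (∀ v, 2 ≤ v → v ≤ n + 1 → 1 ≤ f v ∧ f v < v) ∧ ∀ v, v < 2 ∨ n + 1 < v → f v = 0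

open Classical in
/-- The finite set of all father maps on `{1, …, n + 1}`. -/
noncomputable def fatherMaps : ℕ → Finset (ℕ → ℕ)
  | 0 => {fun _ => 0}
  | n + 1 => (fatherMaps n ×ˢ Icc 1 (n + 1)).image fun q => Function.update q.1 (n + 2) q.2

theorem mem_fatherMaps {n : ℕ} {f : ℕ → ℕ} : f ∈ fatherMaps n ↔ IsFatherMap n f := by
  induction n generalizing f with
  | zero =>
    simp only [fatherMaps, mem_singleton, IsFatherMap]
    constructor
    · rintro rfl
      exact ⟨fun v h₁ h₂ => by omega, fun _ _ => rfl⟩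
    · rintro ⟨-, h⟩
      funext v
      exact h v (by omega)
  | succ n ih =>
    simp only [fatherMaps, mem_image, mem_product, ih, mem_Icc, Prod.exists]
    constructor
    · rintro ⟨g, w, ⟨hg, hw⟩, rfl⟩
      refine ⟨fun v h₁ h₂ => ?_, fun v hv => ?_⟩
      · rcases eq_or_ne v (n + 2) with rfl | hne
        · simp only [Function.update_self]
          omega
        · rw [Function.update_of_ne hne]
          exact hg.1 v h₁ (by omega)
      · rw [Function.update_of_ne (by omega)]
        exact hg.2 v (by omega)
    · rintro ⟨h₁, h₂⟩
      refine ⟨Function.update f (n + 2) 0, f (n + 2), ⟨⟨fun v hv hv' => ?_, fun v hv => ?_⟩, ?_⟩, ?_⟩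
      · rw [Function.update_of_ne (by omega)]
        exact h₁ v hv (by omega)
      · rcases eq_or_ne v (n + 2) with rfl | hne
        · simp
        · rw [Function.update_of_ne hne]
          exact h₂ v (by omega)
      · have := h₁ (n + 2) (by omega) (by omega)
        omega
      · simp

theorem sum_fatherMaps_succ {M : Type*} [AddCommMonoid M] (n : ℕ) (F : (ℕ → ℕ) → M) :
    ∑ f ∈ fatherMaps (n + 1), F f =
      ∑ f ∈ fatherMaps n, ∑ w ∈ Icc 1 (n + 1), F (Function.update f (n + 2) w) := by
  classical
  rw [fatherMaps, sum_image, sum_product]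
  rintro ⟨f, w⟩ hf ⟨g, w'⟩ hg h
  simp only [coe_product, Set.mem_prod, mem_coe, mem_fatherMaps] at hf hg
  simp only at h
  have hw : w = w' := by simpa using congrFun h (n + 2)
  refine Prod.ext ?_ hw
  funext v
  rcases eq_or_ne v (n + 2) with rfl | hne
  -- The update erases the value at `n + 2`, but both maps were 0 there.
  · exact (hf.1.2 _ (by omega)).trans (hg.1.2 _ (by omega)).symm
  · simpa [hne] using congrFun h v

theorem IsFatherMap.le {n : ℕ} {f : ℕ → ℕ} (hf : IsFatherMap n f) (v : ℕ) : f v ≤ v := by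
  by_cases h : 2 ≤ v ∧ v ≤ n + 1
  · exact (hf.1 v h.1 h.2).2.le
  · rw [hf.2 v (by omega)]
    exact v.zero_le

theorem IsFatherMap.iterate_le {n : ℕ} {f : ℕ → ℕ} (hf : IsFatherMap n f) (k v : ℕ) :
    f^[k] v ≤ v := by
  induction k with
  | zero => exact le_rfl
  | succ k ih =>
    rw [Function.iterate_succ_apply']
    exact (hf.le _).trans ih

/-! ### Ancestry, and how a new leaf changes it -/

/-- `v` is reached from `u` by iterating `f`. -/
def Reaches (f : ℕ → ℕ) (u v : ℕ) : Prop := ∃ k, f^[k] u = v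

theorem IsFatherMap.reaches_le {n : ℕ} {f : ℕ → ℕ} (hf : IsFatherMap n f) {u v : ℕ}
    (h : Reaches f u v) : v ≤ u := by
  obtain ⟨k, rfl⟩ := h
  exact hf.iterate_le k u

theorem Reaches.trans {f : ℕ → ℕ} {u v w : ℕ} (h : Reaches f u v) (h' : Reaches f v w) :
    Reaches f u w := by
  obtain ⟨a, rfl⟩ := h
  obtain ⟨b, rfl⟩ := h'
  exact ⟨b + a, Function.iterate_add_apply f b a u⟩

/-- The vertices reached from a given vertex form a chain. -/
theorem IsFatherMap.reaches_iff_of_lt {n : ℕ} {f : ℕ → ℕ} (hf : IsFatherMap n f) {w m v : ℕ}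
    (h : Reaches f w m) (hv : v < m) : Reaches f w v ↔ Reaches f m v := by
  refine ⟨?_, h.trans⟩
  rintro ⟨b, rfl⟩
  obtain ⟨a, rfl⟩ := h
  rcases le_total a b with hab | hab
  · exact ⟨b - a, by rw [← Function.iterate_add_apply, Nat.sub_add_cancel hab]⟩
  · have := hf.iterate_le (a - b) (f^[b] w)
    rw [← Function.iterate_add_apply, Nat.sub_add_cancel hab] at this
    omega

/-- Iterates never increase, so an orbit starting below `n + 2` never meets the changed value. -/
theorem IsFatherMap.iterate_update {n : ℕ} {f : ℕ → ℕ} (hf : IsFatherMap n f) {u w : ℕ}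
    (hu : u ≤ n + 1) (k : ℕ) : (Function.update f (n + 2) w)^[k] u = f^[k] u := by
  induction k with
  | zero => rfl
  | succ k ih =>
    have := hf.iterate_le k u
    rw [Function.iterate_succ_apply', Function.iterate_succ_apply', ih,
      Function.update_of_ne (by omega)]

theorem IsFatherMap.reaches_update {n : ℕ} {f : ℕ → ℕ} (hf : IsFatherMap n f) {u v w : ℕ}
    (hu : u ≤ n + 1) : Reaches (Function.update f (n + 2) w) u v ↔ Reaches f u v := by
  simp only [Reaches, hf.iterate_update hu]

theorem IsFatherMap.reaches_update_last {n : ℕ} {f : ℕ → ℕ} (hf : IsFatherMap n f) {v w : ℕ}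
    (hw : w ≤ n + 1) (hv : v ≠ n + 2) :
    Reaches (Function.update f (n + 2) w) (n + 2) v ↔ Reaches f w v := by
  rw [← hf.reaches_update hw]
  constructor
  · rintro ⟨k, hk⟩
    cases k with
    | zero => exact absurd hk.symm hv
    | succ k => exact ⟨k, by rwa [Function.iterate_succ_apply, Function.update_self] at hk⟩
  · rintro ⟨k, hk⟩
    exact ⟨k + 1, by rwa [Function.iterate_succ_apply, Function.update_self]⟩

/-! ### Weights and the recursion for their sum -/

variable {R : Type*} [CommRing R]

open Classical in
/-- The sum of `a` over the hook of `v` in the tree on `{1, …, n + 1}` with father map `f`. -/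
noncomputable def hookSum (n : ℕ) (f : ℕ → ℕ) (a : ℕ → R) (v : ℕ) : R :=
  ∑ u ∈ Icc 1 (n + 1), if Reaches f u v then a u else 0

/-- The weight of the increasing tree on `{1, …, n + 1}` with father map `f`. -/
noncomputable def weight (x : ℕ → R) (y : ℕ → ℕ → R) (n : ℕ) (f : ℕ → ℕ) : R :=
  ∏ v ∈ Icc 2 (n + 1), (x (f v) * hookSum n f (y v) v)

/-- The array of variables that records how the hooks change when the vertex `s` is added, where
`m` is the largest vertex whose hook uses `s`. -/
def twist (x : ℕ → R) (y : ℕ → ℕ → R) (m s : ℕ) (v u : ℕ) : R :=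
  if v < m then y v u + (if u = m then y v s else 0)
  else if v = m then y m s * x u else y v u

theorem twist_of_lt (x : ℕ → R) (y : ℕ → ℕ → R) {m s v u : ℕ} (h : v < m) :
    twist x y m s v u = y v u + if u = m then y v s else 0 := if_pos h

theorem twist_self (x : ℕ → R) (y : ℕ → ℕ → R) {m s u : ℕ} :
    twist x y m s m u = y m s * x u := by simp [twist]

theorem twist_of_gt (x : ℕ → R) (y : ℕ → ℕ → R) {m s v u : ℕ} (h : m < v) :
    twist x y m s v u = y v u := by
  rw [twist, if_neg h.not_gt, if_neg h.ne']

-- Placing `y v s` in column `m` makes it count exactly when `m` lies in the hook of `v`, as it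
-- would if `s` hung somewhere below `m`.
open Classical in
theorem hookSum_twist_of_lt (x : ℕ → R) (y : ℕ → ℕ → R) {n m s v : ℕ} (f : ℕ → ℕ) (h : v < m)
    (hm : m ∈ Icc 1 (n + 1)) :
    hookSum n f (twist x y m s v) v =
      hookSum n f (y v) v + if Reaches f m v then y v s else 0 := by
  have : ∀ u, (if Reaches f u v then twist x y m s v u else 0) =
      (if Reaches f u v then y v u else 0) +
        if u = m then (if Reaches f m v then y v s else 0) else 0 := by
    intro u
    rw [twist_of_lt x y h]
    by_cases hu : u = m
    · subst hu
      split_ifs <;> simp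
    · simp [hu]
  simp only [hookSum, this, sum_add_distrib, sum_ite_eq', if_pos hm]

/-- The hook sum of `x` at `m` is the total of `x w` over the possible fathers `w` of a leaf added
in the hook of `m`. -/
theorem hookSum_twist_self (x : ℕ → R) (y : ℕ → ℕ → R) {n m s : ℕ} (f : ℕ → ℕ) :
    hookSum n f (twist x y m s m) m = y m s * hookSum n f x m := by
  simp only [hookSum, twist_self, mul_sum, mul_ite, mul_zero]

theorem hookSum_twist_of_gt (x : ℕ → R) (y : ℕ → ℕ → R) {n m s v : ℕ} (f : ℕ → ℕ) (h : m < v) :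
    hookSum n f (twist x y m s v) v = hookSum n f (y v) v := by
  simp only [hookSum, twist_of_gt x y h]

open Classical in
theorem IsFatherMap.hookSum_update {n : ℕ} {f : ℕ → ℕ} (hf : IsFatherMap n f) {v w : ℕ}
    (hw : w ≤ n + 1) (hv : v ≤ n + 1) (a : ℕ → R) :
    hookSum (n + 1) (Function.update f (n + 2) w) a v =
      hookSum n f a v + if Reaches f w v then a (n + 2) else 0 := by
  rw [hookSum, ← insert_Icc_right_eq_Icc_add_one (by omega), sum_insert (by simp), add_comm]
  congr 1
  · refine sum_congr rfl fun u hu => ?_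
    simp only [hf.reaches_update (mem_Icc.1 hu).2]
  · simp only [add_assoc, one_add_one_eq_two, hf.reaches_update_last hw (by omega : v ≠ n + 2)]

theorem IsFatherMap.hookSum_update_last {n : ℕ} {f : ℕ → ℕ} (hf : IsFatherMap n f) {w : ℕ}
    (a : ℕ → R) : hookSum (n + 1) (Function.update f (n + 2) w) a (n + 2) = a (n + 2) := by
  classical
  rw [hookSum, sum_eq_single (n + 2), if_pos ⟨0, rfl⟩]
  · intro u hu hne
    have hu' : u ≤ n + 1 := by
      have := (mem_Icc.1 hu).2
      omega
    rw [if_neg]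
    rw [hf.reaches_update hu']
    intro h
    have := hf.reaches_le h
    omega
  · simp

/-- A product over a finite set, split at one of its elements. -/
theorem prod_split_at {s : Finset ℕ} {m : ℕ} (hm : m ∈ s) (g : ℕ → R) :
    ∏ i ∈ s, g i = g m * (∏ i ∈ s with i < m, g i) * ∏ i ∈ s with m < i, g i := by
  rw [← mul_prod_erase s g hm, ← prod_filter_mul_prod_filter_not (s.erase m) (· < m), mul_assoc]
  congr 3
  · ext i
    simp only [mem_filter, mem_erase]
    exact ⟨fun h => ⟨h.1.2, h.2⟩, fun h => ⟨⟨h.2.ne, h.1⟩, h.2⟩⟩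
  · ext i
    simp only [mem_filter, mem_erase]
    exact ⟨fun h => ⟨h.1.2, by omega⟩, fun h => ⟨⟨h.2.ne', h.1⟩, by omega⟩⟩

theorem IsFatherMap.sum_weight_update {n : ℕ} {f : ℕ → ℕ} (hf : IsFatherMap n f)
    (x : ℕ → R) (y : ℕ → ℕ → R) :
    ∑ w ∈ Icc 1 (n + 1), weight x y (n + 1) (Function.update f (n + 2) w) =
      y (n + 2) (n + 2) * ((∑ w ∈ Icc 1 (n + 1), x w) * weight x y n f +
        ∑ m ∈ Icc 2 (n + 1), weight x (twist x y m (n + 2)) n f) := by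
  classical
  have hweight : ∀ w ∈ Icc 1 (n + 1), weight x y (n + 1) (Function.update f (n + 2) w) =
      y (n + 2) (n + 2) * (x w * weight x y n f +
        ∑ m ∈ Icc 2 (n + 1), (∏ v ∈ Icc 2 (n + 1), x (f v)) *
          ((y m (n + 2) * if Reaches f w m then x w else 0) *
          (∏ v ∈ Icc 2 (n + 1) with v < m, hookSum n f (twist x y m (n + 2) v) v) *
          ∏ v ∈ Icc 2 (n + 1) with m < v, hookSum n f (y v) v)) := by
    intro w hw
    have hw' := (mem_Icc.1 hw).2
    have h₁ : ∀ v ∈ Icc 2 (n + 1), x (Function.update f (n + 2) w v) *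
        hookSum (n + 1) (Function.update f (n + 2) w) (y v) v =
        x (f v) * (hookSum n f (y v) v + if Reaches f w v then y v (n + 2) else 0) := by
      intro v hv
      have := (mem_Icc.1 hv).2
      rw [Function.update_of_ne (by omega), hf.hookSum_update hw' this]
    -- `prod_add_ordered` sorts the expansion by the largest index `m` at which the new summand is
    -- taken: factors below `m` stay whole, those above keep only the old hook sum.
    rw [weight, ← insert_Icc_right_eq_Icc_add_one (by omega), prod_insert (by simp),
      prod_congr rfl h₁, prod_mul_distrib, prod_add_ordered, show n + 1 + 1 = n + 2 from rfl,
      Function.update_self, hf.hookSum_update_last, weight, prod_mul_distrib, ← mul_sum, mul_add,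
      mul_add, mul_add]
    congr 1
    · ring
    · rw [mul_assoc, mul_left_comm, mul_sum, mul_sum, mul_sum, mul_sum, mul_sum]
      refine sum_congr rfl fun m hm => ?_
      by_cases h : Reaches f w m
      · have : ∀ v ∈ (Icc 2 (n + 1)).filter (· < m),
            (hookSum n f (y v) v + if Reaches f w v then y v (n + 2) else 0) =
              hookSum n f (twist x y m (n + 2) v) v := by
          intro v hv
          have hvm := (mem_filter.1 hv).2
          rw [hookSum_twist_of_lt x y f hvm (by simp only [mem_Icc] at hm ⊢; omega)]
          simp only [hf.reaches_iff_of_lt h hvm]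
        rw [prod_congr rfl this, if_pos h, if_pos h]
        ring
      · simp [h]
  rw [sum_congr rfl hweight, ← mul_sum, sum_add_distrib, ← sum_mul, sum_comm]
  congr 2
  refine sum_congr rfl fun m hm => ?_
  -- Now `w` occurs only in `x w` restricted to the hook of `m`; its sum is the twisted factor at
  -- `m`.
  rw [← mul_sum, ← sum_mul, ← sum_mul, ← mul_sum, weight, prod_mul_distrib,
    prod_split_at hm fun v => hookSum n f (twist x y m (n + 2) v) v, hookSum_twist_self]
  congr 2
  refine prod_congr rfl fun v hv => ?_
  rw [hookSum_twist_of_gt x y f (mem_filter.1 hv).2]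

theorem sum_weight_succ (n : ℕ) (x : ℕ → R) (y : ℕ → ℕ → R) :
    ∑ f ∈ fatherMaps (n + 1), weight x y (n + 1) f =
      y (n + 2) (n + 2) * ((∑ w ∈ Icc 1 (n + 1), x w) * ∑ f ∈ fatherMaps n, weight x y n f +
        ∑ m ∈ Icc 2 (n + 1), ∑ f ∈ fatherMaps n, weight x (twist x y m (n + 2)) n f) := by
  rw [sum_fatherMaps_succ, sum_congr rfl fun f hf =>
    (mem_fatherMaps.1 hf).sum_weight_update x y, ← mul_sum, sum_add_distrib, ← mul_sum, sum_comm]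

/-! ### The recursion for the product formula -/

/-- The `i`-th factor of the product formula for trees on `{1, …, n}`. -/
def factor (x : ℕ → R) (y : ℕ → ℕ → R) (n i : ℕ) : R :=
  (∑ j ∈ Icc 1 i, x j * y i i) + ∑ j ∈ Icc (i + 1) n, x i * y i j

theorem factor_twist_of_lt (x : ℕ → R) (y : ℕ → ℕ → R) {n m s i : ℕ} (h : i < m) (hm : m ≤ n) :
    factor x (twist x y m s) n i = factor x y n i + x i * y i s := by
  have hm' : m ∈ Icc (i + 1) n := mem_Icc.2 ⟨h, hm⟩
  simp only [factor, twist_of_lt x y h, mul_add, sum_add_distrib, if_neg h.ne, mul_ite, mul_zero,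
    add_zero, sum_ite_eq', if_pos hm', add_assoc]

theorem factor_twist_self (x : ℕ → R) (y : ℕ → ℕ → R) {n m s : ℕ} (hm : m ≤ n) :
    factor x (twist x y m s) n m = x m * y m s * ∑ j ∈ Icc 1 n, x j := by
  have : Icc 1 n = Icc 1 m ∪ Icc (m + 1) n := by
    ext j
    simp only [mem_Icc, mem_union]
    omega
  rw [this, sum_union (disjoint_left.2 fun j h₁ h₂ => by simp only [mem_Icc] at h₁ h₂; omega),
    mul_add, mul_sum, mul_sum, factor]
  congr 1 <;> refine sum_congr rfl fun j _ => ?_ <;> rw [twist_self] <;> ring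

theorem factor_twist_of_gt (x : ℕ → R) (y : ℕ → ℕ → R) {n m s i : ℕ} (h : m < i) :
    factor x (twist x y m s) n i = factor x y n i := by
  simp only [factor, twist_of_gt x y h]

theorem factor_succ (x : ℕ → R) (y : ℕ → ℕ → R) {n i : ℕ} (h : i ≤ n) :
    factor x y (n + 1) i = factor x y n i + x i * y i (n + 1) := by
  rw [factor, factor, sum_Icc_succ_top (by omega), add_assoc]

/-- The product formula satisfies the same recursion as the sum over father maps. -/
theorem product_formula_succ (n : ℕ) (x : ℕ → R) (y : ℕ → ℕ → R) (a : R) :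
    a * y (n + 3) (n + 3) * ∏ i ∈ Icc 2 (n + 2), factor x y (n + 3) i =
      y (n + 3) (n + 3) * ((∑ w ∈ Icc 1 (n + 2), x w) *
          (a * y (n + 2) (n + 2) * ∏ i ∈ Icc 2 (n + 1), factor x y (n + 2) i) +
        ∑ m ∈ Icc 2 (n + 2), a * twist x y m (n + 3) (n + 2) (n + 2) *
          ∏ i ∈ Icc 2 (n + 1), factor x (twist x y m (n + 3)) (n + 2) i) := by
  have hfac : ∏ i ∈ Icc 2 (n + 1), factor x y (n + 3) i =
      ∏ i ∈ Icc 2 (n + 1), (factor x y (n + 2) i + x i * y i (n + 3)) :=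
    prod_congr rfl fun i hi => factor_succ x y (by have := (mem_Icc.1 hi).2; omega)
  -- The top vertex `m = n + 2` is separate: its twist changes the leading entry `y (n + 2) (n + 2)`
  -- rather than a factor. This term yields the second summand of `htop`; the untwisted term and the
  -- terms of `hmid` yield the first.
  have hlast : ∏ i ∈ Icc 2 (n + 1), factor x (twist x y (n + 2) (n + 3)) (n + 2) i =
      ∏ i ∈ Icc 2 (n + 1), (factor x y (n + 2) i + x i * y i (n + 3)) :=
    prod_congr rfl fun i hi =>
      factor_twist_of_lt x y (by have := (mem_Icc.1 hi).2; omega) le_rfl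
  have hmid : ∀ m ∈ Icc 2 (n + 1), a * twist x y m (n + 3) (n + 2) (n + 2) *
      ∏ i ∈ Icc 2 (n + 1), factor x (twist x y m (n + 3)) (n + 2) i =
      (∑ w ∈ Icc 1 (n + 2), x w) * (a * y (n + 2) (n + 2)) *
        (x m * y m (n + 3) *
          (∏ i ∈ Icc 2 (n + 1) with i < m, (factor x y (n + 2) i + x i * y i (n + 3))) *
          ∏ i ∈ Icc 2 (n + 1) with m < i, factor x y (n + 2) i) := by
    intro m hm
    have hm' := (mem_Icc.1 hm).2
    rw [prod_split_at hm, factor_twist_self x y (by omega), twist_of_gt x y (by omega),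
      prod_congr rfl fun i hi => factor_twist_of_lt x y (mem_filter.1 hi).2 (by omega),
      prod_congr rfl fun i hi => factor_twist_of_gt x y (mem_filter.1 hi).2]
    ring
  have htop : factor x y (n + 3) (n + 2) =
      (∑ w ∈ Icc 1 (n + 2), x w) * y (n + 2) (n + 2) + x (n + 2) * y (n + 2) (n + 3) := by
    simp [factor, sum_mul]
  rw [prod_Icc_succ_top (by omega),
    sum_Icc_succ_top (by omega : 2 ≤ n + 1 + 1) fun m => a * twist x y m (n + 3) (n + 2) (n + 2) * _,
    show n + 1 + 1 = n + 2 from rfl, hlast, hfac, htop,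
    sum_congr rfl hmid, ← mul_sum, twist_self]
  have key := prod_add_ordered (Icc 2 (n + 1)) (fun i => factor x y (n + 2) i)
    (fun i => x i * y i (n + 3))
  linear_combination a * y (n + 3) (n + 3) * (∑ w ∈ Icc 1 (n + 2), x w) * y (n + 2) (n + 2) * key

theorem sum_weight_eq (n : ℕ) (x : ℕ → R) (y : ℕ → ℕ → R) :
    ∑ f ∈ fatherMaps (n + 1), weight x y (n + 1) f =
      x 1 * y (n + 2) (n + 2) * ∏ i ∈ Icc 2 (n + 1), factor x y (n + 2) i := by
  induction n generalizing y with
  | zero =>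
    -- On two vertices the recursion starts from the empty product, and there is no `m` to sum over.
    rw [sum_weight_succ]
    simp [fatherMaps, weight, mul_comm]
  | succ n ih =>
    rw [sum_weight_succ, product_formula_succ, ih, sum_congr rfl fun m _ => ih _]

end FatherMap

/-! ### Rooted trees and their father maps -/

namespace RootedTreeOn

open SimpleGraph

section

variable {V : Type*} (T : RootedTreeOn V)

theorem father_eq_snd {v : V} {q : T.graph.Walk v T.root} (hq : q.IsPath) : T.father v = q.snd := by
  rw [father, ← (T.pathToRoot_spec v).2 q hq]

theorem father_root : T.father T.root = T.root :=
  T.father_eq_snd (q := .nil) Walk.IsPath.nil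

theorem adj_father {v : V} (hv : v ≠ T.root) : T.graph.Adj v (T.father v) :=
  Walk.adj_snd (Walk.not_nil_of_ne hv)

open Classical in
theorem mem_hook_iff [Fintype V] {u v : V} : u ∈ T.hook v ↔ Relation.ReflTransGen T.IsSon u v := by
  rw [Relation.reflTransGen_iff_eq_or_transGen, hook, Finset.mem_filter, @eq_comm _ v u]
  exact and_iff_right (Finset.mem_univ u)

end

section

variable {V : Type*} [LinearOrder V]

/-- The graph whose edges join the vertices `v` to `p v`. -/
def fatherGraph (p : V → V) : SimpleGraph V := SimpleGraph.fromRel fun u v => p u = v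

theorem fatherGraph_adj {p : V → V} {v : V} (hv : p v < v) : (fatherGraph p).Adj v (p v) :=
  (fromRel_adj _ _ _).2 ⟨hv.ne', Or.inl rfl⟩

variable [Finite V] {p : V → V} {ρ : V}

/-- The bound on the support is carried along because it keeps `v` off the path from `p v`, so that
prepending `v` gives a path again. -/
theorem exists_path_fatherGraph (hρ : p ρ = ρ) (hp : ∀ v, v ≠ ρ → p v < v) (v : V) :
    ∃ q : (fatherGraph p).Walk v ρ, q.IsPath ∧ (∀ u ∈ q.support, u ≤ v) ∧ q.snd = p v := by
  induction v using WellFoundedLT.induction with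
  | ind v ih =>
    by_cases hv : v = ρ
    · subst hv
      exact ⟨.nil, .nil, by simp, hρ.symm⟩
    · obtain ⟨q, hq, hle, -⟩ := ih (p v) (hp v hv)
      refine ⟨.cons (fatherGraph_adj (hp v hv)) q, ?_, ?_, Walk.snd_cons _ _⟩
      · exact (Walk.cons_isPath_iff _ _).2 ⟨hq, fun h => (hle v h).not_gt (hp v hv)⟩
      · intro u hu
        rw [Walk.support_cons, List.mem_cons] at hu
        rcases hu with rfl | hu
        · exact le_rfl
        · exact (hle u hu).trans (hp v hv).le

theorem fatherGraph_connected (hρ : p ρ = ρ) (hp : ∀ v, v ≠ ρ → p v < v) :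
    (fatherGraph p).Connected := by
  have : Nonempty V := ⟨ρ⟩
  have h : ∀ v, (fatherGraph p).Reachable v ρ := fun v =>
    (exists_path_fatherGraph hρ hp v).elim fun q _ => ⟨q⟩
  exact ⟨fun u v => (h u).trans (h v).symm⟩

/-- Every edge is `s(v, p v)` with `v ≠ ρ`, so there are at most `|V| - 1` edges; a connected graph
with so few is a tree. -/
theorem fatherGraph_isTree (hρ : p ρ = ρ) (hp : ∀ v, v ≠ ρ → p v < v) :
    (fatherGraph p).IsTree := by
  classical
  have := Fintype.ofFinite V
  have hconn := fatherGraph_connected hρ hp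
  refine isTree_iff_connected_and_card.2 ⟨hconn,
    le_antisymm ?_ hconn.card_vert_le_card_edgeSet_add_one⟩
  have hsub : (fatherGraph p).edgeSet ⊆
      ((Finset.univ.erase ρ).image fun v => s(v, p v) : Finset (Sym2 V)) := by
    intro e
    induction e with
    | _ u v =>
      rw [mem_edgeSet, fatherGraph, fromRel_adj, Finset.mem_coe, Finset.mem_image]
      rintro ⟨hne, h | h⟩
      · refine ⟨u, Finset.mem_erase.2 ⟨?_, Finset.mem_univ u⟩, by rw [h]⟩
        rintro rfl
        exact hne (hρ.symm.trans h)
      · refine ⟨v, Finset.mem_erase.2 ⟨?_, Finset.mem_univ v⟩, by rw [h, Sym2.eq_swap]⟩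
        rintro rfl
        exact hne (h.symm.trans hρ)
  have hcard : Nat.card (fatherGraph p).edgeSet ≤ (Finset.univ.erase ρ).card := by
    have := Set.ncard_le_ncard hsub (Finset.finite_toSet _)
    rw [Set.ncard_coe_finset] at this
    exact this.trans Finset.card_image_le
  rw [Nat.card_eq_fintype_card (α := V), ← Finset.card_univ,
    ← Finset.card_erase_add_one (Finset.mem_univ ρ)]
  omega

/-- The rooted tree with a given father map. -/
def ofFather (hρ : p ρ = ρ) (hp : ∀ v, v ≠ ρ → p v < v) : RootedTreeOn V :=
  ⟨fatherGraph p, fatherGraph_isTree hρ hp, ρ⟩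

theorem father_ofFather (hρ : p ρ = ρ) (hp : ∀ v, v ≠ ρ → p v < v) (v : V) :
    (ofFather hρ hp).father v = p v := by
  obtain ⟨q, hq, -, hsnd⟩ := exists_path_fatherGraph hρ hp v
  exact (father_eq_snd (ofFather hρ hp) hq).trans hsnd

theorem ofFather_isIncreasing (hρ : p ρ = ρ) (hp : ∀ v, v ≠ ρ → p v < v) :
    (ofFather hρ hp).IsIncreasing := by
  rintro u v ⟨hu, rfl⟩
  rw [father_ofFather]
  exact hp u hu

/-- A tree is minimal among connected graphs, and the edges from vertices to their fathers already
form a connected subgraph. -/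
theorem IsIncreasing.graph_eq {T : RootedTreeOn V} (hT : T.IsIncreasing) :
    T.graph = fatherGraph T.father := by
  have hlt : ∀ v, v ≠ T.root → T.father v < v := fun v hv => hT v _ ⟨hv, rfl⟩
  refine ((isTree_iff_minimal_connected.1 T.isTree).eq_of_le
    (fatherGraph_connected T.father_root hlt) fun u v h => ?_).symm
  obtain ⟨hne, rfl | rfl⟩ := (fromRel_adj _ _ _).1 h
  · exact T.adj_father fun h => hne (by rw [h, father_root])
  · exact (T.adj_father fun h => hne (by rw [h, father_root])).symm

/-- An increasing tree is determined by its root and its father map. -/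
theorem IsIncreasing.eq_of_father_eq {S T : RootedTreeOn V} (hS : S.IsIncreasing)
    (hT : T.IsIncreasing) (hroot : S.root = T.root) (h : S.father = T.father) : S = T :=
  RootedTreeOn.ext (by rw [hS.graph_eq, hT.graph_eq, h]) hroot

end

/-! ### Increasing trees on `{1, …, n + 1}` correspond to father maps -/

section

open Finset FatherMap

variable {n : ℕ}

/-- The vertex `1`. -/
def firstVertex (n : ℕ) : Vertex (n + 1) := ⟨1, by simp⟩

theorem two_le_of_ne_firstVertex {v : Vertex (n + 1)} (hv : v ≠ firstVertex n) : 2 ≤ (v : ℕ) := by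
  have := (mem_Icc.1 v.2).1
  by_contra h
  exact hv (Subtype.ext (show (v : ℕ) = 1 by omega))

theorem IsIncreasing.root_eq {T : RootedTreeOn (Vertex (n + 1))} (hT : T.IsIncreasing) :
    T.root = firstVertex n := by
  by_contra h
  have h' : T.father (firstVertex n) < firstVertex n := hT _ _ ⟨fun h' => h h'.symm, rfl⟩
  have h₁ := (mem_Icc.1 (T.father (firstVertex n)).2).1
  have h₂ : (T.father (firstVertex n) : ℕ) < 1 := h'
  omega

/-- The father map of a tree on `{1, …, n + 1}`, extended by `0`. -/
noncomputable def natFather (T : RootedTreeOn (Vertex (n + 1))) (v : ℕ) : ℕ :=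
  if h : 2 ≤ v ∧ v ≤ n + 1 then T.father ⟨v, mem_Icc.2 ⟨by omega, h.2⟩⟩ else 0

theorem natFather_coe (T : RootedTreeOn (Vertex (n + 1))) {v : Vertex (n + 1)} (hv : 2 ≤ (v : ℕ)) :
    T.natFather v = T.father v :=
  dif_pos ⟨hv, (mem_Icc.1 v.2).2⟩

theorem IsIncreasing.isFatherMap {T : RootedTreeOn (Vertex (n + 1))} (hT : T.IsIncreasing) :
    IsFatherMap n T.natFather := by
  refine ⟨fun v h₁ h₂ => ?_, fun v hv => dif_neg (by omega)⟩
  have hv : v ∈ Icc 1 (n + 1) := mem_Icc.2 ⟨by omega, h₂⟩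
  rw [T.natFather_coe (v := ⟨v, hv⟩) h₁]
  refine ⟨(mem_Icc.1 (T.father _).2).1, hT ⟨v, hv⟩ _ ⟨?_, rfl⟩⟩
  rw [hT.root_eq]
  intro h
  have : v = 1 := congrArg Subtype.val h
  omega

theorem IsIncreasing.reaches_natFather {T : RootedTreeOn (Vertex (n + 1))} (hT : T.IsIncreasing)
    {u v : Vertex (n + 1)} : Reaches T.natFather u v ↔ u ∈ T.hook v := by
  rw [mem_hook_iff]
  constructor
  · rintro ⟨k, hk⟩
    induction k generalizing u with
    | zero =>
      obtain rfl : u = v := Subtype.ext hk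
      exact .refl
    | succ k ih =>
      rw [Function.iterate_succ_apply] at hk
      by_cases hu : u = firstVertex n
      -- The extended map sends 1 to 0 and its iterates stay there, so they never reach a vertex.
      · have h₀ : T.natFather u = 0 := dif_neg (by rw [hu]; simp [firstVertex])
        have := hT.isFatherMap.iterate_le k 0
        have := (mem_Icc.1 v.2).1
        rw [h₀] at hk
        omega
      · rw [T.natFather_coe (two_le_of_ne_firstVertex hu)] at hk
        exact .head ⟨fun h => hu (h.trans hT.root_eq), rfl⟩ (ih hk)
  · intro h
    induction h using Relation.ReflTransGen.head_induction_on with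
    | refl => exact ⟨0, rfl⟩
    | @head a c h' _ ih =>
      obtain ⟨k, hk⟩ := ih
      obtain ⟨ha, rfl⟩ := h'
      refine ⟨k + 1, ?_⟩
      rwa [Function.iterate_succ_apply,
        T.natFather_coe (two_le_of_ne_firstVertex fun h => ha (h.trans hT.root_eq.symm))]

theorem IsIncreasing.hookWeight_eq {R : Type*} [CommRing R] (x : ℕ → R) (y : ℕ → ℕ → R)
    {T : RootedTreeOn (Vertex (n + 1))} (hT : T.IsIncreasing) :
    hookWeight x y T = weight x y n T.natFather := by
  classical
  have hhook : ∀ (v : Vertex (n + 1)) (a : ℕ → R),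
      ∑ u ∈ T.hook v, a u = hookSum n T.natFather a v := by
    intro v a
    rw [hookSum, ← sum_coe_sort (Icc 1 (n + 1)), ← sum_filter]
    refine sum_congr ?_ fun _ _ => rfl
    ext u
    simp [hT.reaches_natFather]
  rw [hookWeight, weight]
  refine prod_bij (fun v _ => (v : ℕ)) (fun v hv => ?_) (fun v _ w _ h => Subtype.ext h)
    (fun v hv => ?_) fun v hv => ?_
  · exact mem_Icc.2 ⟨(mem_filter.1 hv).2, (mem_Icc.1 v.2).2⟩
  · have := mem_Icc.1 hv
    exact ⟨⟨v, mem_Icc.2 ⟨by omega, this.2⟩⟩, mem_filter.2 ⟨mem_univ _, this.1⟩, rfl⟩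
  · rw [hhook, T.natFather_coe (mem_filter.1 hv).2]

theorem exists_natFather_eq {f : ℕ → ℕ} (hf : IsFatherMap n f) :
    ∃ T : RootedTreeOn (Vertex (n + 1)), T.IsIncreasing ∧ T.natFather = f := by
  let p : Vertex (n + 1) → Vertex (n + 1) := fun v =>
    -- Since `f 1 = 0` is out of range, the default value makes the vertex 1 a fixed point, as a
    -- root must be.
    if h : f v ∈ Icc 1 (n + 1) then ⟨f v, h⟩ else firstVertex n
  have hval : ∀ v : Vertex (n + 1), 2 ≤ (v : ℕ) → (p v : ℕ) = f v := by
    intro v hv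
    have hle := (mem_Icc.1 v.2).2
    have := hf.1 v hv hle
    simp only [p]
    rw [dif_pos (mem_Icc.2 ⟨this.1, by omega⟩)]
  have hroot : p (firstVertex n) = firstVertex n := by
    have : f (firstVertex n : ℕ) = 0 := hf.2 1 (by omega)
    exact dif_neg (by simp [this])
  have hlt : ∀ v, v ≠ firstVertex n → p v < v := by
    intro v hv
    have h₂ := two_le_of_ne_firstVertex hv
    change (p v : ℕ) < v
    rw [hval v h₂]
    exact (hf.1 v h₂ (mem_Icc.1 v.2).2).2
  refine ⟨ofFather hroot hlt, ofFather_isIncreasing hroot hlt, ?_⟩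
  funext v
  by_cases hv : 2 ≤ v ∧ v ≤ n + 1
  · rw [natFather, dif_pos hv, father_ofFather, hval _ hv.1]
  · rw [natFather, dif_neg hv, hf.2 v (by omega)]

theorem IsIncreasing.eq_of_natFather_eq {S T : RootedTreeOn (Vertex (n + 1))}
    (hS : S.IsIncreasing) (hT : T.IsIncreasing) (h : S.natFather = T.natFather) : S = T := by
  have hroot : S.root = T.root := hS.root_eq.trans hT.root_eq.symm
  refine hS.eq_of_father_eq hT hroot (funext fun v => ?_)
  by_cases hv : v = S.root
  · rw [hv, father_root, hroot, father_root]
  · have h₂ := two_le_of_ne_firstVertex fun h => hv (h.trans hS.root_eq.symm)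
    exact Subtype.ext (by rw [← S.natFather_coe h₂, ← T.natFather_coe h₂, h])

theorem sum_hookWeight_eq {R : Type*} [CommRing R] (n : ℕ) (x : ℕ → R) (y : ℕ → ℕ → R) :
    ∑ T ∈ increasingTrees (n + 1), hookWeight x y T = ∑ f ∈ fatherMaps n, weight x y n f := by
  have hmem : ∀ T : RootedTreeOn (Vertex (n + 1)),
      T ∈ increasingTrees (n + 1) ↔ T.IsIncreasing := fun T => by simp [increasingTrees]
  refine sum_bij (fun T _ => T.natFather) (fun T hT => ?_) (fun S hS T hT h => ?_)
    (fun f hf => ?_) fun T hT => ?_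
  · exact mem_fatherMaps.2 ((hmem T).1 hT).isFatherMap
  · exact ((hmem S).1 hS).eq_of_natFather_eq ((hmem T).1 hT) h
  · obtain ⟨T, hT, rfl⟩ := exists_natFather_eq (mem_fatherMaps.1 hf)
    exact ⟨T, (hmem T).2 hT, rfl⟩
  · exact ((hmem T).1 hT).hookWeight_eq x y

end

end RootedTreeOn

theorem theorem1 {R : Type*} [CommRing R] (r : ℕ) (hr : 2 ≤ r) (x : ℕ → R) (y : ℕ → ℕ → R) :
    ∑ T ∈ increasingTrees r, hookWeight x y T =
      x 1 * y r r *
        ∏ i ∈ Finset.Icc 2 (r - 1),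
          ((∑ j ∈ Finset.Icc 1 i, x j * y i i) + (∑ j ∈ Finset.Icc (i + 1) r, x i * y i j)) := by
  obtain ⟨n, rfl⟩ := Nat.exists_eq_add_of_le' hr
  exact (RootedTreeOn.sum_hookWeight_eq (n + 1) x y).trans (FatherMap.sum_weight_eq n x y)
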